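/- Let $\mathbf D=\{z\in\mathbb C:|z|<1\}$. Denote by $A^{-\infty}$ the class of analytic functions $f$ in $\mathbf D$ for which there exist constants $C,k$ such that $|f(z)|\le C(1-|z|)^{-k}$ for all $z\in\mathbf D$. For $f\in A^{-\infty}$ put \[ D_+(f)=\Big\{\theta\in[0,2\pi):\ \liminf_{r\to1^-}\frac{\log|f(re^{i\theta})|}{|\log(1-r)|}>0\Big\},\qquad G_+(f)=\Big\{\theta\in[0,2\pi):\ \limsup_{r\to1^-}\frac{\log|f(re^{i\theta})|}{|\log(1-r)|}>0\Big\}. \] Let $\lambda(t)=t|\log t|$ for $0<t<1$, $\lambda(0)=0$, and let $H_\lambda$ be the corresponding Hausdorff measure on the real line, \[ H_\lambda(E)=\lim_{\varepsilon\to0^+}\inf\Big\{\sum_s\lambda(|J_s|):\ E\subset\bigcup_s J_s,\ |J_s|<\varepsilon\Big\}, \] where the infimum is over countable coverings of $E$ by intervals $J_s$ of length $|J_s|$. \textbf{Theorem.} (i) If $f\in A^{-\infty}$ and $|f|$ is bounded from below on $\mathbf D$ by a positive constant, then $G_+(f)$ is a countable union of sets of finite $H_\lambda$-measure. (ii) There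 exists $f\in A^{-\infty}$ such that $|f|$ is bounded from below on $\mathbf D$ by a positive constant and $H_\lambda(D_+(f))=\infty$. -/

import Mathlib

open MeasureTheory Set Filter Topology

noncomputable section

/-- The class `A^{-∞}`: analytic functions in the unit disc with
`|f(z)| ≤ C / (1 - |z|)^k` for some constants `C` and `k`. -/
def IsKorenblum (f : ℂ → ℂ) : Prop :=
  AnalyticOnNhd ℂ f (Metric.ball 0 1) ∧
    ∃ C k : ℝ, ∀ z ∈ Metric.ball (0 : ℂ) 1, ‖f z‖ ≤ C / (1 - ‖z‖) ^ k

/-- `|f|` is bounded from below in the unit disc by a positive constant. -/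
def IsBoundedBelowOnDisc (f : ℂ → ℂ) : Prop :=
  ∃ c : ℝ, 0 < c ∧ ∀ z ∈ Metric.ball (0 : ℂ) 1, c ≤ ‖f z‖

/-- The quotient `log |f(r e^{iθ})| / |log (1 - r)|`, as an extended real number
(`log 0 = -∞`). -/
def radialRatio (f : ℂ → ℂ) (θ r : ℝ) : EReal :=
  ENNReal.log ‖f (r * Complex.exp (θ * Complex.I))‖ₑ / ((|Real.log (1 - r)| : ℝ) : EReal)

/-- `D_+(f)`: the lower limit of the quotient as `r → 1` from the left is positive. -/
def DPlus (f : ℂ → ℂ) : Set ℝ :=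
  {θ | θ ∈ Ico 0 (2 * Real.pi) ∧ 0 < liminf (radialRatio f θ) (𝓝[<] 1)}

/-- `G_+(f)`: the upper limit of the quotient as `r → 1` from the left is positive. -/
def GPlus (f : ℂ → ℂ) : Set ℝ :=
  {θ | θ ∈ Ico 0 (2 * Real.pi) ∧ 0 < limsup (radialRatio f θ) (𝓝[<] 1)}

/-- The Hausdorff measure `H_h` on the real line for the gauge function `h`. -/
def gaugeMeasure (h : ℝ → ℝ) : Measure ℝ :=
  Measure.mkMetric fun t => ENNReal.ofReal (h t.toReal)

/-- `H_h` is given by countable coverings by intervals `J n` of small length. -/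
theorem gaugeMeasure_apply (h : ℝ → ℝ) (h0 : h 0 = 0) (s : Set ℝ) :
    gaugeMeasure h s = ⨆ (ε : ENNReal) (_ : 0 < ε), ⨅ (J : ℕ → Set ℝ)
      (_ : ∀ n, (J n).OrdConnected) (_ : s ⊆ ⋃ n, J n) (_ : ∀ n, Metric.ediam (J n) ≤ ε),
        ∑' n, ENNReal.ofReal (h (Metric.ediam (J n)).toReal) := by
  have key : ∀ t : Set ℝ, (⨆ _ : t.Nonempty, ENNReal.ofReal (h (Metric.ediam t).toReal)) =
      ENNReal.ofReal (h (Metric.ediam t).toReal) := by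
    intro t
    rcases t.eq_empty_or_nonempty with rfl | ht
    · simp [h0]
    · simp [ht]
  rw [gaugeMeasure, Measure.mkMetric_apply]
  simp only [key]
  refine iSup_congr fun ε => iSup_congr fun _ => le_antisymm ?_ ?_
  · refine le_iInf fun J => le_iInf fun _ => le_iInf fun hs => le_iInf fun hd => ?_
    exact iInf_le_of_le J (iInf_le_of_le hs (iInf_le_of_le hd le_rfl))
  · refine le_iInf fun t => le_iInf fun hs => le_iInf fun hd => ?_
    refine iInf_le_of_le (fun n => convexHull ℝ (t n)) (iInf_le_of_le ?_ (iInf_le_of_le ?_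
      (iInf_le_of_le ?_ ?_)))
    · exact fun n => (convex_convexHull ℝ (t n)).ordConnected
    · exact hs.trans (iUnion_mono fun n => subset_convexHull ℝ (t n))
    · intro n
      simpa using hd n
    · simp

end

/-! (i) Since f has no zeros, u = log|f| - log c is a nonnegative harmonic function, and the
measures u(ρe^{it})dt have the same mass for every ρ. An ultrafilter of radii ρ → 1 replaces their
weak limit. Splitting the Poisson kernel dyadically shows that u can reach a multiple of |log h| at
height h above θ only if some small interval of radius s about θ has mass at least ε s|log s|
(`exists_scale_mass_ge`). A Vitali covering by such intervals has bounded total λ, so each level set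
of the upper limit has finite H_λ-measure (`gaugeMeasure_lt_top_of_mass`).

(ii) Random binary digits, forced to be 0 at the positions 2^m with m ≥ K, give a probability
measure whose cylinders of length n have mass about 2^{-K} λ(2^{-n}) for large n. By the mass
distribution principle, sets of full measure have H_λ at least a constant times 2^K
(`le_gaugeMeasure_of_cantorMeasure`). All these measures satisfy one upper bound O(λ), so the
exponential of the Herglotz integral of their mixture lies in A^{-∞} (`re_herglotzIntegral_le`), and
its modulus is at least 1. Each component alone forces logarithmic growth along almost all of its
radii (`le_re_herglotzIntegral_cantorMixture`). Letting K → ∞ gives infinite measure. -/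

/-! ### Distances in the disc and dyadic splitting of the kernel. -/

theorem radialRatio_eq_coe {f : ℂ → ℂ} {θ r : ℝ} (hf : f (r * Complex.exp (θ * Complex.I)) ≠ 0) :
    radialRatio f θ r =
      ((Real.log ‖f (r * Complex.exp (θ * Complex.I))‖ / |Real.log (1 - r)| : ℝ) : EReal) := by
  rw [radialRatio, ← ofReal_norm, ENNReal.log_ofReal_of_pos (norm_pos_iff.2 hf), EReal.coe_div]

theorem mul_exp_mem_ball {r θ : ℝ} (h0 : 0 ≤ r) (h1 : r < 1) :
    (r : ℂ) * Complex.exp (θ * Complex.I) ∈ Metric.ball (0 : ℂ) 1 := by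
  simp [Complex.norm_exp_ofReal_mul_I, abs_of_nonneg h0, h1]

theorem norm_mul_exp_sub_mul_exp_sq (ρ r t θ : ℝ) :
    ‖(ρ : ℂ) * Complex.exp (t * Complex.I) - r * Complex.exp (θ * Complex.I)‖ ^ 2 =
      (ρ - r) ^ 2 + 4 * ρ * r * Real.sin ((t - θ) / 2) ^ 2 := by
  have h : Real.sin ((t - θ) / 2) ^ 2 = 1 / 2 - Real.cos (t - θ) / 2 := by
    rw [Real.sin_sq_eq_half_sub]; ring_nf
  rw [h, Real.cos_sub, ← Complex.normSq_eq_norm_sq, Complex.normSq_apply]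
  simp only [Complex.sub_re, Complex.mul_re, Complex.ofReal_re, Complex.exp_ofReal_mul_I_re,
    Complex.ofReal_im, Complex.exp_ofReal_mul_I_im, Complex.sub_im, Complex.mul_im]
  linear_combination ρ ^ 2 * Real.sin_sq_add_cos_sq t + r ^ 2 * Real.sin_sq_add_cos_sq θ

theorem sq_div_pi_le_sin_half_sq {x : ℝ} (hx : |x| ≤ Real.pi) :
    (x / Real.pi) ^ 2 ≤ Real.sin (x / 2) ^ 2 := by
  have h := Real.mul_abs_le_abs_sin (x := x / 2) (by
    rw [abs_div, abs_two]; linarith)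
  rw [← sq_abs (Real.sin _), ← sq_abs (x / _)]
  have e : |x / Real.pi| = 2 / Real.pi * |x / 2| := by
    rw [abs_div, abs_div, abs_two, abs_of_pos Real.pi_pos]; ring
  rw [e]
  gcongr

/-- The Poisson-type kernel at scale `h` is dominated by a weighted sum of indicators of balls
of radii `2 ^ j * h`. -/
theorem div_max_sq_le_dyadic_sum {h d : ℝ} (hh : 0 < h) (J : ℕ) :
    h / max (h ^ 2) (d ^ 2) ≤
      (∑ j ∈ Finset.range (J + 1), 4 * (4 ^ j : ℝ)⁻¹ / h * (if |d| ≤ 2 ^ j * h then 1 else 0))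
        + (4 ^ J : ℝ)⁻¹ / h := by
  have base : h / max (h ^ 2) (d ^ 2) ≤ 1 / h := by
    rw [div_le_div_iff₀ (by positivity) hh]
    nlinarith [le_max_left (h ^ 2) (d ^ 2)]
  have far : ∀ n : ℕ, ¬ |d| ≤ 2 ^ n * h → h / max (h ^ 2) (d ^ 2) ≤ (4 ^ n : ℝ)⁻¹ / h := by
    intro n hn
    push Not at hn
    have h1 : (2 ^ n * h) ^ 2 ≤ d ^ 2 := by
      rw [← sq_abs d]; gcongr
    have h2 : (4 : ℝ) ^ n * h ^ 2 ≤ max (h ^ 2) (d ^ 2) := by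
      refine le_trans (le_of_eq ?_) (h1.trans (le_max_right _ _))
      rw [mul_pow, ← pow_mul, mul_comm n 2, pow_mul]; norm_num
    calc h / max (h ^ 2) (d ^ 2) ≤ h / (4 ^ n * h ^ 2) := by gcongr
      _ = (4 ^ n : ℝ)⁻¹ / h := by field_simp
  have nonneg : ∀ j : ℕ, 0 ≤ 4 * (4 ^ j : ℝ)⁻¹ / h * (if |d| ≤ 2 ^ j * h then 1 else 0) := by
    intro j; split_ifs <;> positivity
  induction J with
  | zero =>
    have := Finset.sum_nonneg fun j (_ : j ∈ Finset.range (0 + 1)) => nonneg j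
    simp only [pow_zero, inv_one] at this ⊢
    linarith
  | succ J ih =>
    by_cases hd : |d| ≤ 2 ^ (J + 1) * h
    · rw [Finset.sum_range_succ, if_pos hd]
      -- The factor 4 in the weights makes the new term equal to the old remainder.
      have : 4 * (4 ^ (J + 1) : ℝ)⁻¹ / h * 1 = (4 ^ J : ℝ)⁻¹ / h := by
        rw [pow_succ]; field_simp
      have : (0 : ℝ) ≤ (4 ^ (J + 1))⁻¹ / h := by positivity
      linarith
    · have := Finset.sum_nonneg fun j (_ : j ∈ Finset.range (J + 1 + 1)) => nonneg j
      have := far _ hd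
      linarith

/-- Kernel weight 4^{-j} against interval length 2^j: summing over all scales costs only a constant.
-/
theorem sum_inv_four_pow_mul_two_pow_le (J : ℕ) :
    ∑ j ∈ Finset.range J, (4 ^ j : ℝ)⁻¹ * 2 ^ j ≤ 2 := by
  have : ∀ j : ℕ, (4 ^ j : ℝ)⁻¹ * 2 ^ j = (1 / 2) ^ j := by
    intro j
    rw [← inv_pow, ← mul_pow]; norm_num
  simp_rw [this]
  exact (Summable.sum_le_tsum _ (fun _ _ => by positivity) summable_geometric_two).trans
    tsum_geometric_two.le

/-! ### Positive harmonic functions and their masses on circles. -/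

section PositiveHarmonic

variable {u : ℂ → ℝ}

theorem continuous_harmonic_circleMap
    (hu : InnerProductSpace.HarmonicOnNhd u (Metric.ball 0 1)) {ρ : ℝ} (h0 : 0 ≤ ρ) (h1 : ρ < 1) :
    Continuous fun t => u (circleMap 0 ρ t) := by
  have hc : ContinuousOn u (Metric.ball 0 1) := fun z hz =>
    (hu z hz).1.continuousAt.continuousWithinAt
  refine hc.comp_continuous (continuous_circleMap 0 ρ) fun t => ?_
  simp [abs_of_nonneg h0, h1]

theorem integral_circleMap_harmonic
    (hu : InnerProductSpace.HarmonicOnNhd u (Metric.ball 0 1)) {ρ : ℝ} (h0 : 0 ≤ ρ) (h1 : ρ < 1)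
    (a : ℝ) : ∫ t in a..a + 2 * Real.pi, u (circleMap 0 ρ t) = 2 * Real.pi * u 0 := by
  have hsub : Metric.closedBall (0 : ℂ) |ρ| ⊆ Metric.ball 0 1 := by
    rw [abs_of_nonneg h0]; exact Metric.closedBall_subset_ball h1
  have h := InnerProductSpace.HarmonicOnNhd.circleAverage_eq (hu.mono hsub)
  rw [Real.circleAverage_def] at h
  have hper : Function.Periodic (fun t => u (circleMap 0 ρ t)) (2 * Real.pi) := fun t => by
    simp [periodic_circleMap 0 ρ t]
  rw [hper.intervalIntegral_add_eq a 0, zero_add, ← h, smul_eq_mul, mul_inv_cancel_left₀]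
  positivity

/-- The numerator is at most 2h. In the squared distance, the radial part is at least (h/2)² ≥
h²/π², and the angular part is at least (t-θ)²/π² by Jordan's inequality. -/
theorem poissonKernel_le_div_max {h ρ θ t : ℝ} (hh : 0 < h) (hh4 : h ≤ 1 / 4)
    (hρ : 1 - h / 2 ≤ ρ) (hρ1 : ρ < 1) (ht : |t - θ| ≤ Real.pi) :
    poissonKernel 0 ((1 - h : ℝ) * Complex.exp (θ * Complex.I)) (circleMap 0 ρ t) ≤
      2 * Real.pi ^ 2 * (h / max (h ^ 2) ((t - θ) ^ 2)) := by
  have hπ := Real.pi_pos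
  have hπ2 : 4 ≤ Real.pi ^ 2 := by nlinarith [Real.pi_gt_three]
  have e1 : circleMap 0 ρ t = (ρ : ℂ) * Complex.exp (t * Complex.I) := by simp [circleMap]
  have e2 := norm_mul_exp_sub_mul_exp_sq ρ (1 - h) t θ
  rw [poissonKernel_def, sub_zero, sub_zero, e1, e2]
  have n1 : ‖(ρ : ℂ) * Complex.exp (t * Complex.I)‖ = ρ := by
    rw [norm_mul, Complex.norm_exp_ofReal_mul_I, mul_one, Complex.norm_real, Real.norm_eq_abs,
      abs_of_nonneg (by linarith)]
  have n2 : ‖((1 - h : ℝ) : ℂ) * Complex.exp (θ * Complex.I)‖ = 1 - h := by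
    rw [norm_mul, Complex.norm_exp_ofReal_mul_I, mul_one, Complex.norm_real, Real.norm_eq_abs,
      abs_of_nonneg (by linarith)]
  rw [n1, n2]
  have hs := sq_div_pi_le_sin_half_sq ht
  have hm : max (h ^ 2) ((t - θ) ^ 2) / Real.pi ^ 2 ≤
      (ρ - (1 - h)) ^ 2 + 4 * ρ * (1 - h) * Real.sin ((t - θ) / 2) ^ 2 := by
    rw [div_le_iff₀ (by positivity)]
    have a1 : (h / 2) ^ 2 ≤ (ρ - (1 - h)) ^ 2 := by
      apply pow_le_pow_left₀ (by positivity); linarith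
    have a2 : 1 ≤ 4 * ρ * (1 - h) := by nlinarith
    have a3 : (0 : ℝ) ≤ Real.sin ((t - θ) / 2) ^ 2 := sq_nonneg _
    have a4 : Real.sin ((t - θ) / 2) ^ 2 ≤ 4 * ρ * (1 - h) * Real.sin ((t - θ) / 2) ^ 2 :=
      le_mul_of_one_le_left a3 a2
    rw [div_pow, div_le_iff₀ (by positivity)] at hs
    have a5 : (0 : ℝ) ≤ (ρ - (1 - h)) ^ 2 := sq_nonneg _
    refine max_le ?_ ?_ <;> nlinarith
  calc (ρ ^ 2 - (1 - h) ^ 2) / _ ≤ (2 * h) / (max (h ^ 2) ((t - θ) ^ 2) / Real.pi ^ 2) := by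
        have : 0 < max (h ^ 2) ((t - θ) ^ 2) := lt_max_of_lt_left (by positivity)
        gcongr
        nlinarith
    _ = _ := by
        have : 0 < max (h ^ 2) ((t - θ) ^ 2) := lt_max_of_lt_left (by positivity)
        field_simp

/-- A positive harmonic function is controlled by the dyadic averages of its values on a
larger circle. -/
theorem harmonic_le_dyadic_sum (hu : InnerProductSpace.HarmonicOnNhd u (Metric.ball 0 1))
    (h0 : ∀ z ∈ Metric.ball (0 : ℂ) 1, 0 ≤ u z) {h ρ : ℝ} (θ : ℝ) (hh : 0 < h) (hh4 : h ≤ 1 / 4)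
    (hρ : 1 - h / 2 ≤ ρ) (hρ1 : ρ < 1) (J : ℕ) :
    u ((1 - h : ℝ) * Complex.exp (θ * Complex.I)) ≤
      Real.pi * ((∑ j ∈ Finset.range (J + 1), 4 * (4 ^ j : ℝ)⁻¹ / h *
        ∫ t in Metric.closedBall θ (2 ^ j * h), u (circleMap 0 ρ t)) +
        (4 ^ J : ℝ)⁻¹ / h * (2 * Real.pi * u 0)) := by
  have hπ := Real.pi_pos
  have hρ0 : 0 ≤ ρ := by linarith
  set w : ℂ := (1 - h : ℝ) * Complex.exp (θ * Complex.I) with hw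
  have nw : ‖w‖ = 1 - h := by
    rw [hw, norm_mul, Complex.norm_exp_ofReal_mul_I, mul_one, Complex.norm_real, Real.norm_eq_abs,
      abs_of_nonneg (by linarith)]
  have hwρ : w ∈ Metric.ball (0 : ℂ) ρ := by
    rw [mem_ball_zero_iff, nw]; linarith
  have hv := continuous_harmonic_circleMap hu hρ0 hρ1
  have hv0 : ∀ t, 0 ≤ u (circleMap 0 ρ t) := fun t => h0 _ (by simp [abs_of_nonneg hρ0, hρ1])
  have key := InnerProductSpace.HarmonicOnNhd.circleAverage_poissonKernel_smul
    (hu.mono (Metric.closedBall_subset_ball hρ1)) hwρ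
  have hper : Function.Periodic (fun t => (poissonKernel 0 w • u) (circleMap 0 ρ t))
      (2 * Real.pi) := fun t => by simp [periodic_circleMap 0 ρ t]
  -- Recentring the period at θ gives |t - θ| ≤ π, as the kernel bound requires.
  rw [Real.circleAverage_def, ← zero_add (2 * Real.pi),
    hper.intervalIntegral_add_eq 0 (θ - Real.pi), zero_add] at key
  have hle : θ - Real.pi ≤ θ - Real.pi + 2 * Real.pi := by linarith
  have hP : Continuous fun t => (poissonKernel 0 w • u) (circleMap 0 ρ t) := by
    have : Continuous fun t => poissonKernel 0 w (circleMap 0 ρ t) := by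
      simp only [poissonKernel_def]
      refine Continuous.div (by fun_prop) (by fun_prop) fun t => ?_
      have : circleMap 0 ρ t - w ≠ 0 := by
        intro e
        have : ‖circleMap 0 ρ t‖ = ‖w‖ := by rw [sub_eq_zero.1 e]
        rw [nw, norm_circleMap_zero, abs_of_nonneg hρ0] at this
        linarith
      simpa using this
    exact this.mul hv
  set g : ℕ → ℝ → ℝ := fun j t => 4 * (4 ^ j : ℝ)⁻¹ / h *
    (Metric.closedBall θ (2 ^ j * h)).indicator (fun t => u (circleMap 0 ρ t)) t with hg
  have hgi : ∀ j a b, IntervalIntegrable (g j) volume a b := by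
    intro j a b
    apply IntervalIntegrable.const_mul
    rw [intervalIntegrable_iff]
    exact ((intervalIntegrable_iff.1 (hv.intervalIntegrable a b)).indicator
      Metric.isClosed_closedBall.measurableSet)
  have hgb : ∀ j a b, a ≤ b → ∫ t in a..b, g j t ≤ 4 * (4 ^ j : ℝ)⁻¹ / h *
      ∫ t in Metric.closedBall θ (2 ^ j * h), u (circleMap 0 ρ t) := by
    intro j a b hab
    rw [hg, intervalIntegral.integral_const_mul]
    gcongr
    rw [intervalIntegral.integral_of_le hab,
      setIntegral_indicator Metric.isClosed_closedBall.measurableSet]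
    refine setIntegral_mono_set ?_ (ae_of_all _ hv0) (ae_of_all _ inter_subset_right)
    exact hv.continuousOn.integrableOn_compact (isCompact_closedBall _ _)
  have hbound : ∀ t ∈ Icc (θ - Real.pi) (θ - Real.pi + 2 * Real.pi),
      (poissonKernel 0 w • u) (circleMap 0 ρ t) ≤ 2 * Real.pi ^ 2 *
        ((∑ j ∈ Finset.range (J + 1), g j t) + (4 ^ J : ℝ)⁻¹ / h * u (circleMap 0 ρ t)) := by
    intro t ht
    have ht' : |t - θ| ≤ Real.pi := by rw [abs_le]; constructor <;> linarith [ht.1, ht.2]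
    have b1 := poissonKernel_le_div_max (θ := θ) hh hh4 hρ hρ1 ht'
    have b2 := div_max_sq_le_dyadic_sum (d := t - θ) hh J
    calc poissonKernel 0 w (circleMap 0 ρ t) * u (circleMap 0 ρ t)
        ≤ (2 * Real.pi ^ 2 * ((∑ j ∈ Finset.range (J + 1), 4 * (4 ^ j : ℝ)⁻¹ / h *
          (if |t - θ| ≤ 2 ^ j * h then 1 else 0)) + (4 ^ J : ℝ)⁻¹ / h)) * u (circleMap 0 ρ t) := by
          refine mul_le_mul_of_nonneg_right (b1.trans ?_) (hv0 t)
          exact mul_le_mul_of_nonneg_left b2 (by positivity)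
      _ = _ := by
          rw [mul_assoc, add_mul, Finset.sum_mul]
          congr 3
          funext j
          simp only [hg, indicator, Metric.mem_closedBall, Real.dist_eq]
          split_ifs <;> ring
  have hS : ∀ a b, IntervalIntegrable (∑ j ∈ Finset.range (J + 1), g j) volume a b :=
    fun a b => IntervalIntegrable.sum _ fun j _ => hgi j a b
  have hint := intervalIntegral.integral_mono_on (μ := volume) hle (hP.intervalIntegrable _ _)
    (((hS _ _).add ((hv.intervalIntegrable _ _).const_mul ((4 ^ J : ℝ)⁻¹ / h))).const_mul (2 * Real.pi ^ 2))
    (by simpa [Finset.sum_apply] using hbound)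
  rw [intervalIntegral.integral_const_mul, intervalIntegral.integral_add (hS _ _)
    ((hv.intervalIntegrable _ _).const_mul _), intervalIntegral.integral_const_mul,
    integral_circleMap_harmonic hu hρ0 hρ1] at hint
  have hsum : ∫ t in (θ - Real.pi)..(θ - Real.pi + 2 * Real.pi),
      (∑ j ∈ Finset.range (J + 1), g j) t ≤ ∑ j ∈ Finset.range (J + 1), 4 * (4 ^ j : ℝ)⁻¹ / h *
        ∫ t in Metric.closedBall θ (2 ^ j * h), u (circleMap 0 ρ t) := by
    simp only [Finset.sum_apply]
    rw [intervalIntegral.integral_finsetSum fun j _ => hgi j _ _]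
    exact Finset.sum_le_sum fun j _ => hgb j _ _ hle
  rw [← key, smul_eq_mul]
  have e : ∀ X : ℝ, (2 * Real.pi)⁻¹ * (2 * Real.pi ^ 2 * X) = Real.pi * X := by
    intro X; field_simp
  rw [← e]
  refine mul_le_mul_of_nonneg_left (hint.trans ?_) (by positivity)
  exact mul_le_mul_of_nonneg_left (by gcongr) (by positivity)

/-- If every scale up to δ carried mass below ε s|log s|, the dyadic terms would contribute at most
8πε|log h| and the remainder at most πε ≤ πε|log h|, against the assumed 9πε|log h|. -/
theorem exists_scale_mass_ge (hu : InnerProductSpace.HarmonicOnNhd u (Metric.ball 0 1))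
    (h0 : ∀ z ∈ Metric.ball (0 : ℂ) 1, 0 ≤ u z) {U : Ultrafilter ℝ} (hU : (U : Filter ℝ) ≤ 𝓝[<] 1)
    {ε δ : ℝ} (hε : 0 < ε) (hδ : 0 < δ) (hδ1 : δ ≤ 1) :
    ∃ h₀ > 0, ∀ θ h : ℝ, 0 < h → h < h₀ →
      9 * Real.pi * ε * |Real.log h| < u ((1 - h : ℝ) * Complex.exp (θ * Complex.I)) →
      ∃ s, 0 < s ∧ s ≤ δ ∧
        ∀ᶠ ρ in (U : Filter ℝ), ε * (s * |Real.log s|) ≤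
          ∫ t in Metric.closedBall θ s, u (circleMap 0 ρ t) := by
  have hπ := Real.pi_pos
  have hu0 : 0 ≤ u 0 := h0 0 (by simp)
  -- The bound 1/4 serves the kernel estimate and gives |log h| ≥ 1; the last bound makes the
  -- remainder small, with +1 covering u 0 = 0.
  refine ⟨min δ (min (1 / 4) (ε * δ ^ 2 / (8 * Real.pi * u 0 + 1))), by positivity, ?_⟩
  intro θ h hh hlt hgt
  have hhδ : h < δ := hlt.trans_le (min_le_left _ _)
  have hh4 : h ≤ 1 / 4 := (hlt.trans_le ((min_le_right _ _).trans (min_le_left _ _))).le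
  have hhε : h * (8 * Real.pi * u 0 + 1) < ε * δ ^ 2 := by
    rw [← lt_div_iff₀ (by positivity)]
    exact hlt.trans_le ((min_le_right _ _).trans (min_le_right _ _))
  have hlog : Real.log h ≤ -1 := by
    rw [Real.log_le_iff_le_exp hh]
    refine hh4.trans ?_
    rw [Real.exp_neg, one_div]
    exact inv_anti₀ (Real.exp_pos _) (by linarith [Real.exp_one_lt_d9])
  have hL : |Real.log h| = -Real.log h := abs_of_nonpos (by linarith)
  obtain ⟨J, hJ1, hJ2⟩ := exists_nat_pow_near ((one_le_div hh).2 hhδ.le) (one_lt_two (α := ℝ))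
  rw [le_div_iff₀ hh] at hJ1
  rw [div_lt_iff₀ hh] at hJ2
  -- For an ultrafilter, failure to hold eventually means that the opposite holds eventually; hence
  -- the finitely many dyadic scales fail at one common ρ.
  by_contra hcon
  push Not at hcon
  have hall : ∀ᶠ ρ in (U : Filter ℝ), ∀ j ∈ Finset.range (J + 1),
      ∫ t in Metric.closedBall θ (2 ^ j * h), u (circleMap 0 ρ t) <
        ε * (2 ^ j * h * |Real.log (2 ^ j * h)|) := by
    rw [Filter.eventually_all_finset]
    intro j hj
    have hjJ : (2 : ℝ) ^ j * h ≤ δ := by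
      refine le_trans ?_ hJ1
      gcongr
      · norm_num
      · exact Nat.lt_succ_iff.1 (Finset.mem_range.1 hj)
    exact hcon (2 ^ j * h) (by positivity) hjJ
  have hρ : ∀ᶠ ρ in (U : Filter ℝ), 1 - h / 2 ≤ ρ ∧ ρ < 1 := by
    refine hU ?_
    filter_upwards [Ioo_mem_nhdsLT (show 1 - h / 2 < 1 by linarith)] with ρ hρ
    exact ⟨hρ.1.le, hρ.2⟩
  obtain ⟨ρ, hρa, hρ1, hρ2⟩ := (hall.and hρ).exists
  have main := harmonic_le_dyadic_sum hu h0 θ hh hh4 hρ1 hρ2 J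
  have s1 : ∑ j ∈ Finset.range (J + 1), 4 * (4 ^ j : ℝ)⁻¹ / h *
      ∫ t in Metric.closedBall θ (2 ^ j * h), u (circleMap 0 ρ t) ≤ 8 * (ε * |Real.log h|) := by
    calc _ ≤ ∑ j ∈ Finset.range (J + 1), 4 * (ε * |Real.log h|) * ((4 ^ j : ℝ)⁻¹ * 2 ^ j) := by
          refine Finset.sum_le_sum fun j hj => ?_
          have hjJ : (2 : ℝ) ^ j * h ≤ δ := by
            refine le_trans ?_ hJ1
            gcongr
            · norm_num
            · exact Nat.lt_succ_iff.1 (Finset.mem_range.1 hj)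
          have hl : |Real.log (2 ^ j * h)| ≤ |Real.log h| := by
            rw [hL, abs_of_nonpos (Real.log_nonpos (by positivity) (hjJ.trans hδ1))]
            apply neg_le_neg
            exact Real.log_le_log hh (le_mul_of_one_le_left hh.le (one_le_pow₀ (by norm_num)))
          calc _ ≤ 4 * (4 ^ j : ℝ)⁻¹ / h * (ε * (2 ^ j * h * |Real.log h|)) := by
                refine mul_le_mul_of_nonneg_left ((hρa j hj).le.trans ?_) (by positivity)
                gcongr
            _ = _ := by field_simp
      _ = 4 * (ε * |Real.log h|) * ∑ j ∈ Finset.range (J + 1), ((4 ^ j : ℝ)⁻¹ * 2 ^ j) := by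
          rw [Finset.mul_sum]
      _ ≤ 4 * (ε * |Real.log h|) * 2 := by
          gcongr
          exact sum_inv_four_pow_mul_two_pow_le _
      _ = _ := by ring
  have s2 : (4 ^ J : ℝ)⁻¹ / h * (2 * Real.pi * u 0) ≤ ε := by
    have q : δ ^ 2 ≤ 4 * 4 ^ J * h ^ 2 := by
      have : δ ^ 2 ≤ (2 ^ (J + 1) * h) ^ 2 := by gcongr
      refine this.trans (le_of_eq ?_)
      have : (4 : ℝ) ^ J = (2 ^ J) ^ 2 := by rw [← pow_mul, mul_comm, pow_mul]; norm_num
      rw [this]; ring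
    rw [inv_eq_one_div, div_div, div_mul_eq_mul_div, one_mul, div_le_iff₀ (by positivity)]
    have : h * (8 * Real.pi * u 0) ≤ ε * (4 * 4 ^ J * h ^ 2) := by
      nlinarith [mul_le_mul_of_nonneg_left q hε.le]
    have e : h * (4 * (2 * Real.pi * u 0)) ≤ h * (4 * (ε * (4 ^ J * h))) := by
      linarith
    have := le_of_mul_le_mul_left e hh
    linarith
  have hLge : 1 ≤ |Real.log h| := by rw [hL]; linarith
  have : Real.pi * (8 * (ε * |Real.log h|) + ε) ≤ 9 * Real.pi * ε * |Real.log h| := by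
    have : Real.pi * ε * 1 ≤ Real.pi * ε * |Real.log h| := by gcongr
    linarith
  have := mul_le_mul_of_nonneg_left (add_le_add s1 s2) hπ.le
  linarith

end PositiveHarmonic

/-! ### The covering argument and the first assertion. -/

theorem ofReal_mul_abs_log_ediam_closedBall_le {θ s : ℝ} (hs : 0 < s) (hs1 : s ≤ 1 / 10) :
    ENNReal.ofReal ((Metric.ediam (Metric.closedBall θ (5 * s))).toReal *
      |Real.log (Metric.ediam (Metric.closedBall θ (5 * s))).toReal|) ≤
      ENNReal.ofReal (10 * (s * |Real.log s|)) := by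
  have e : (Metric.ediam (Metric.closedBall θ (5 * s))).toReal = 10 * s := by
    rw [Real.closedBall_eq_Icc, Real.ediam_Icc, ENNReal.toReal_ofReal (by linarith)]; ring
  rw [e, mul_assoc]
  apply ENNReal.ofReal_le_ofReal
  refine mul_le_mul_of_nonneg_left (mul_le_mul_of_nonneg_left ?_ hs.le) (by norm_num)
  rw [abs_of_nonpos (Real.log_nonpos (by positivity) (by linarith)),
    abs_of_nonpos (Real.log_nonpos hs.le (by linarith))]
  exact neg_le_neg (Real.log_le_log hs (by linarith))

/-- A set of angles at which, at arbitrarily small scales `s`, the boundary mass of a positive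
harmonic function is at least `ε s |log s|` has finite Hausdorff measure. -/
theorem gaugeMeasure_lt_top_of_mass {u : ℂ → ℝ}
    (hu : InnerProductSpace.HarmonicOnNhd u (Metric.ball 0 1))
    (h0 : ∀ z ∈ Metric.ball (0 : ℂ) 1, 0 ≤ u z) {U : Ultrafilter ℝ} (hU : (U : Filter ℝ) ≤ 𝓝[<] 1)
    {ε : ℝ} (hε : 0 < ε) {S : Set ℝ} (hS : S ⊆ Icc 0 (2 * Real.pi))
    (hmass : ∀ δ, 0 < δ → δ ≤ 1 → ∀ θ ∈ S, ∃ s, 0 < s ∧ s ≤ δ ∧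
      ∀ᶠ ρ in (U : Filter ℝ), ε * (s * |Real.log s|) ≤
        ∫ t in Metric.closedBall θ s, u (circleMap 0 ρ t)) :
    gaugeMeasure (fun t => t * |Real.log t|) S < ⊤ := by
  have hπ := Real.pi_pos
  set A : ℝ := 10 * (ε⁻¹ * (3 * (2 * Real.pi * u 0))) with hA
  have cover : ∀ n : ℕ, ∃ b : Set (ℝ × ℝ), b.Countable ∧
      (∀ p ∈ b, 0 < p.2 ∧ p.2 ≤ 1 / (10 * ((n : ℝ) + 1))) ∧
      S ⊆ ⋃ p ∈ b, Metric.closedBall p.1 (5 * p.2) ∧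
      ∀ F : Finset (ℝ × ℝ), ↑F ⊆ b → ∑ p ∈ F, 10 * (p.2 * |Real.log p.2|) ≤ A := by
    intro n
    -- The fivefold enlargements then have diameter at most 1/(n+1).
    set δ : ℝ := 1 / (10 * ((n : ℝ) + 1)) with hδ
    have hn : (0 : ℝ) ≤ n := n.cast_nonneg
    have hδ0 : 0 < δ := by positivity
    have hδ1 : δ ≤ 1 := by
      rw [hδ, div_le_one (by positivity)]; linarith
    set T : Set (ℝ × ℝ) := {p | p.1 ∈ S ∧ 0 < p.2 ∧ p.2 ≤ δ ∧
      ∀ᶠ ρ in (U : Filter ℝ), ε * (p.2 * |Real.log p.2|) ≤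
        ∫ t in Metric.closedBall p.1 p.2, u (circleMap 0 ρ t)} with hT
    obtain ⟨b, hbT, hdis, hcov⟩ := Vitali.exists_disjoint_subfamily_covering_enlargement_closedBall
      T Prod.fst Prod.snd δ (fun p hp => hp.2.2.1) 5 (by norm_num)
    refine ⟨b, ?_, fun p hp => ⟨(hbT hp).2.1, (hbT hp).2.2.1⟩, ?_, ?_⟩
    · refine hdis.countable_of_nonempty_interior fun p hp => ?_
      refine ⟨p.1, ?_⟩
      exact mem_interior_iff_mem_nhds.2 (Metric.closedBall_mem_nhds _ (hbT hp).2.1)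
    · intro θ hθ
      obtain ⟨s, hs, hsδ, hsU⟩ := hmass δ hδ0 hδ1 θ hθ
      obtain ⟨p, hp, hsub⟩ := hcov (θ, s) ⟨hθ, hs, hsδ, hsU⟩
      exact mem_iUnion₂.2 ⟨p, hp, hsub (Metric.mem_closedBall_self hs.le)⟩
    · intro F hF
      -- A finite subfamily can be tested at a single ρ, where the masses of disjoint balls add up.
      have ev : ∀ᶠ ρ in (U : Filter ℝ), ∀ p ∈ F, ε * (p.2 * |Real.log p.2|) ≤
          ∫ t in Metric.closedBall p.1 p.2, u (circleMap 0 ρ t) := by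
        rw [Filter.eventually_all_finset]
        exact fun p hp => (hbT (hF hp)).2.2.2
      have hρ : ∀ᶠ ρ in (U : Filter ℝ), 0 ≤ ρ ∧ ρ < 1 := by
        refine hU ?_
        filter_upwards [Ioo_mem_nhdsLT (zero_lt_one (α := ℝ))] with ρ hρ
        exact ⟨hρ.1.le, hρ.2⟩
      obtain ⟨ρ, hρF, hρ0, hρ1⟩ := (ev.and hρ).exists
      have hv := continuous_harmonic_circleMap hu hρ0 hρ1
      have hv0 : ∀ t, 0 ≤ u (circleMap 0 ρ t) := fun t => h0 _ (by simp [abs_of_nonneg hρ0, hρ1])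
      -- Balls centred in [0, 2π] may stick out of that period; three periods contain them all.
      have tot : ∫ t in Icc (-(2 * Real.pi)) (4 * Real.pi), u (circleMap 0 ρ t) =
          3 * (2 * Real.pi * u 0) := by
        have i := fun a b => hv.intervalIntegrable (μ := volume) a b
        rw [integral_Icc_eq_integral_Ioc, ← intervalIntegral.integral_of_le (by linarith),
          ← intervalIntegral.integral_add_adjacent_intervals (i _ 0) (i 0 _),
          ← intervalIntegral.integral_add_adjacent_intervals (i 0 (2 * Real.pi)) (i _ _)]
        have e1 := integral_circleMap_harmonic hu hρ0 hρ1 (-(2 * Real.pi))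
        have e2 := integral_circleMap_harmonic hu hρ0 hρ1 0
        have e3 := integral_circleMap_harmonic hu hρ0 hρ1 (2 * Real.pi)
        rw [neg_add_cancel] at e1
        rw [zero_add] at e2
        rw [show 2 * Real.pi + 2 * Real.pi = 4 * Real.pi by ring] at e3
        rw [e1, e2, e3]; ring
      have hsum : ∑ p ∈ F, ∫ t in Metric.closedBall p.1 p.2, u (circleMap 0 ρ t) ≤
          3 * (2 * Real.pi * u 0) := by
        rw [← integral_biUnion_finset (μ := volume) F
          (fun p _ => Metric.isClosed_closedBall.measurableSet) (hdis.subset hF)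
          (fun p _ => hv.continuousOn.integrableOn_compact (isCompact_closedBall _ _)), ← tot]
        refine setIntegral_mono_set (hv.continuousOn.integrableOn_compact isCompact_Icc)
          (ae_of_all _ hv0) (LE.le.eventuallyLE ?_)
        intro x hx
        obtain ⟨p, hp, hxp⟩ := mem_iUnion₂.1 hx
        have h1 := hS (hbT (hF hp)).1
        have h2 := (hbT (hF hp)).2.2.1
        rw [Metric.mem_closedBall, Real.dist_eq, abs_le] at hxp
        have := Real.pi_gt_three
        constructor <;> linarith [h1.1, h1.2, hxp.1, hxp.2]
      rw [← Finset.mul_sum, hA]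
      refine mul_le_mul_of_nonneg_left ?_ (by norm_num)
      rw [le_inv_mul_iff₀ hε, Finset.mul_sum]
      exact (Finset.sum_le_sum hρF).trans hsum
  choose b hbc hbs hbS hbF using cover
  have hcount : ∀ n, Countable (b n) := fun n => (hbc n).to_subtype
  have hle := Measure.mkMetric_le_liminf_tsum (ι := fun n => b n) (l := atTop) S
    (fun n : ℕ => ENNReal.ofReal (1 / ((n : ℝ) + 1)))
    (by
      have := ENNReal.tendsto_ofReal tendsto_one_div_add_atTop_nhds_zero_nat
      simpa only [ENNReal.ofReal_zero] using this)
    (fun n p => Metric.closedBall p.1.1 (5 * p.1.2))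
    (Eventually.of_forall fun n p => by
      rw [Real.closedBall_eq_Icc, Real.ediam_Icc]
      apply ENNReal.ofReal_le_ofReal
      have h1 := (hbs n _ p.2).2
      have e : 1 / ((n : ℝ) + 1) = 10 * (1 / (10 * ((n : ℝ) + 1))) := by field_simp
      rw [e]; linarith)
    (Eventually.of_forall fun n => by
      rw [iUnion_coe_set]; exact hbS n)
    (fun t => ENNReal.ofReal (t.toReal * |Real.log t.toReal|))
  refine lt_of_le_of_lt (hle.trans ?_) (ENNReal.ofReal_lt_top (r := A))
  refine (liminf_le_of_frequently_le (Frequently.of_forall fun n => ?_))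
  rw [ENNReal.tsum_eq_iSup_sum]
  refine iSup_le fun F => ?_
  calc _ ≤ ∑ p ∈ F, ENNReal.ofReal (10 * (p.1.2 * |Real.log p.1.2|)) := by
        refine Finset.sum_le_sum fun p _ => ?_
        have h1 := hbs n _ p.2
        refine ofReal_mul_abs_log_ediam_closedBall_le h1.1 (h1.2.trans ?_)
        have hn : (0 : ℝ) ≤ n := n.cast_nonneg
        gcongr
        linarith
    _ = ENNReal.ofReal (∑ p ∈ F, 10 * (p.1.2 * |Real.log p.1.2|)) := by
        rw [ENNReal.ofReal_sum_of_nonneg]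
        intro p hp
        have := (hbs n _ p.2).1
        positivity
    _ ≤ ENNReal.ofReal A := by
        apply ENNReal.ofReal_le_ofReal
        have := hbF n (F.map (Function.Embedding.subtype _)) (by
          intro p hp
          simp only [Finset.coe_map, Function.Embedding.subtype_apply, mem_image] at hp
          obtain ⟨q, _, rfl⟩ := hp
          exact q.2)
        rwa [Finset.sum_map] at this

theorem tendsto_one_sub_nhdsLT_one : Tendsto (fun r : ℝ => 1 - r) (𝓝[<] 1) (𝓝[>] 0) := by
  refine tendsto_nhdsWithin_iff.2 ⟨?_, ?_⟩
  · have : Tendsto (fun r : ℝ => 1 - r) (𝓝 1) (𝓝 (1 - 1)) := by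
      exact (continuous_const.sub continuous_id).tendsto 1
    rw [sub_self] at this
    exact this.mono_left nhdsWithin_le_nhds
  · filter_upwards [self_mem_nhdsWithin] with r hr
    exact sub_pos.2 (mem_Iio.1 hr)

theorem tendsto_abs_log_nhdsGT_zero : Tendsto (fun h : ℝ => |Real.log h|) (𝓝[>] 0) atTop :=
  tendsto_abs_atBot_atTop.comp Real.tendsto_log_nhdsGT_zero

theorem exists_iUnion_eq_GPlus {f : ℂ → ℂ} (hf : IsKorenblum f) (hb : IsBoundedBelowOnDisc f) :
    ∃ S : ℕ → Set ℝ, GPlus f = ⋃ n, S n ∧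
      ∀ n, gaugeMeasure (fun t => t * |Real.log t|) (S n) < ⊤ := by
  have hπ := Real.pi_pos
  obtain ⟨c, hc, hcf⟩ := hb
  have hne : ∀ z ∈ Metric.ball (0 : ℂ) 1, f z ≠ 0 := fun z hz =>
    norm_pos_iff.1 (hc.trans_le (hcf z hz))
  set u : ℂ → ℝ := fun z => Real.log ‖f z‖ - Real.log c with hu_def
  have hu : InnerProductSpace.HarmonicOnNhd u (Metric.ball 0 1) := by
    intro z hz
    exact ((hf.1 z hz).harmonicAt_log_norm (hne z hz)).sub (InnerProductSpace.harmonicAt_const _)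
  have h0 : ∀ z ∈ Metric.ball (0 : ℂ) 1, 0 ≤ u z := fun z hz =>
    sub_nonneg.2 (Real.log_le_log hc (hcf z hz))
  have hU : ((Ultrafilter.of (𝓝[<] (1 : ℝ)) : Ultrafilter ℝ) : Filter ℝ) ≤ 𝓝[<] 1 :=
    Ultrafilter.of_le _
  refine ⟨fun n => {θ | θ ∈ Ico 0 (2 * Real.pi) ∧
    (((1 / ((n : ℝ) + 1) : ℝ)) : EReal) < limsup (radialRatio f θ) (𝓝[<] 1)}, ?_, fun n => ?_⟩
  · ext θ
    simp only [GPlus, mem_ofPred_eq, mem_iUnion, exists_and_left, and_congr_right_iff]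
    intro _
    constructor
    · intro h
      obtain ⟨q, hq0, hq⟩ := EReal.lt_iff_exists_real_btwn.1 h
      obtain ⟨n, hn⟩ := exists_nat_one_div_lt (EReal.coe_pos.1 hq0)
      exact ⟨n, lt_trans (EReal.coe_lt_coe_iff.2 hn) hq⟩
    · rintro ⟨n, hn⟩
      exact lt_trans (EReal.coe_pos.2 (by positivity)) hn
  · set q : ℝ := 1 / ((n : ℝ) + 1) with hq
    have hq0 : 0 < q := by positivity
    -- This ε makes 9πε = q/2; the other half of q|log(1-r)| absorbs log c.
    refine gaugeMeasure_lt_top_of_mass hu h0 hU (ε := q / (18 * Real.pi)) (by positivity)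
      (fun θ hθ => Ico_subset_Icc_self hθ.1) ?_
    intro δ hδ hδ1 θ hθ
    obtain ⟨h₀, hh₀, key⟩ := exists_scale_mass_ge hu h0 hU
      (ε := q / (18 * Real.pi)) (by positivity) hδ hδ1
    have fr := frequently_lt_of_lt_limsup (by isBoundedDefault) hθ.2
    have ev1 : ∀ᶠ r : ℝ in 𝓝[<] 1, r ∈ Ioo (0 : ℝ) 1 := Ioo_mem_nhdsLT zero_lt_one
    have ev2 : ∀ᶠ r : ℝ in 𝓝[<] 1, 1 - r < h₀ :=
      tendsto_one_sub_nhdsLT_one.eventually (eventually_of_mem (Ioo_mem_nhdsGT hh₀) fun _ h => h.2)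
    have ev3 : ∀ᶠ r : ℝ in 𝓝[<] 1, max 1 (2 * Real.log c / q) < |Real.log (1 - r)| :=
      (tendsto_abs_log_nhdsGT_zero.comp tendsto_one_sub_nhdsLT_one).eventually_gt_atTop _
    obtain ⟨r, hr, hr1, hr2, hr3⟩ := (fr.and_eventually (ev1.and (ev2.and ev3))).exists
    refine key θ (1 - r) (sub_pos.2 hr1.2) hr2 ?_
    have hz := mul_exp_mem_ball (θ := θ) hr1.1.le hr1.2
    rw [radialRatio_eq_coe (hne _ hz), EReal.coe_lt_coe_iff] at hr
    have hL : 0 < |Real.log (1 - r)| := lt_trans (by positivity) hr3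
    rw [lt_div_iff₀ hL] at hr
    have h3 := (le_max_right _ _).trans_lt hr3
    rw [div_lt_iff₀ hq0] at h3
    have e : 9 * Real.pi * (q / (18 * Real.pi)) = q / 2 := by field_simp; norm_num
    rw [e, sub_sub_cancel]
    simp only [hu_def]
    linarith

/-! ### Cantor-type measures from random binary digits. -/

noncomputable section

theorem exists_dyadic_scale {s : ℝ} (hs : 0 < s) (hs1 : s ≤ 1) :
    ∃ n : ℕ, s ≤ 1 / 2 ^ n ∧ 1 / 2 ^ n < 2 * s ∧ (n : ℝ) ≤ 2 * |Real.log s| ∧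
      |Real.log s| ≤ (n : ℝ) + 1 := by
  obtain ⟨n, h1, h2⟩ := exists_nat_pow_near ((one_le_div hs).2 hs1) (one_lt_two (α := ℝ))
  have hlog2 : 1 / 2 ≤ Real.log 2 := by linarith [Real.log_two_gt_d9]
  have hlog2' : Real.log 2 ≤ 1 := by linarith [Real.log_two_lt_d9]
  have hl : |Real.log s| = Real.log (1 / s) := by
    rw [abs_of_nonpos (Real.log_nonpos hs.le hs1), one_div, Real.log_inv]
  have hn : (0 : ℝ) ≤ n := n.cast_nonneg
  refine ⟨n, ?_, ?_, ?_, ?_⟩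
  · rw [le_div_iff₀ (by positivity), mul_comm]
    exact (le_div_iff₀ hs).1 h1
  · rw [div_lt_iff₀ hs] at h2
    rw [div_lt_iff₀ (by positivity)]
    rw [pow_succ] at h2
    linarith
  · have := Real.log_le_log (by positivity) h1
    rw [Real.log_pow] at this
    rw [hl]
    nlinarith
  · have := Real.log_le_log (by positivity) h2.le
    rw [Real.log_pow] at this
    push_cast at this
    rw [hl]
    nlinarith

/-- The number of digits among the first `n` which are frozen. -/
def frozenCount (K n : ℕ) : ℕ := Nat.clog 2 n - K

theorem frozenCount_mono (K : ℕ) : Monotone (frozenCount K) := fun _ _ h =>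
  Nat.sub_le_sub_right (Nat.clog_mono_right 2 h) K

/-- Unit jumps make 2^`frozenCount` / 2^n constant across a frozen position and halved across a free
one, exactly like the mass of a charged cylinder. -/
theorem frozenCount_succ_le (K n : ℕ) : frozenCount K (n + 1) ≤ frozenCount K n + 1 := by
  have : Nat.clog 2 (n + 1) ≤ Nat.clog 2 n + 1 := by
    rw [Nat.clog_le_iff_le_pow one_lt_two]
    have := Nat.le_pow_clog one_lt_two n
    have := Nat.one_le_two_pow (n := Nat.clog 2 n)
    rw [pow_succ]; omega
  unfold frozenCount; omega

theorem two_pow_clog_le {n : ℕ} (hn : 1 ≤ n) : 2 ^ Nat.clog 2 n ≤ 2 * n := by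
  rcases hn.eq_or_lt with rfl | h
  · simp
  · have h1 := Nat.pow_pred_clog_lt_self one_lt_two h
    have h2 : 0 < Nat.clog 2 n := Nat.clog_pos one_lt_two h
    have h3 : Nat.clog 2 n = (Nat.clog 2 n).pred + 1 := by
      rw [Nat.pred_eq_sub_one]; omega
    rw [h3, pow_succ]; omega

theorem two_pow_frozenCount_le {n : ℕ} (K : ℕ) (hn : 1 ≤ n) :
    (2 : ℝ) ^ frozenCount K n ≤ 2 * n := by
  have h1 : 2 ^ frozenCount K n ≤ 2 ^ Nat.clog 2 n :=
    Nat.pow_le_pow_right two_pos (Nat.sub_le _ _)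
  exact_mod_cast h1.trans (two_pow_clog_le hn)

/-- From 2^K on, the subtraction in `frozenCount` is not truncated. The factor 2^{-K} gained here is
what makes the Hausdorff measure large. -/
theorem two_pow_frozenCount_le_div {K n : ℕ} (hn : 2 ^ K ≤ n) :
    (2 : ℝ) ^ frozenCount K n ≤ 2 * n / 2 ^ K := by
  have hK : K ≤ Nat.clog 2 n := by
    have := Nat.clog_mono_right 2 hn
    rwa [Nat.clog_pow 2 K one_lt_two] at this
  rw [le_div_iff₀ (by positivity), ← pow_add]
  have : frozenCount K n + K = Nat.clog 2 n := Nat.sub_add_cancel hK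
  rw [this]
  exact_mod_cast two_pow_clog_le (Nat.one_le_two_pow.trans hn)

theorem div_le_two_pow_frozenCount (K n : ℕ) : (n : ℝ) / 2 ^ K ≤ 2 ^ frozenCount K n := by
  rw [div_le_iff₀ (by positivity), ← pow_add]
  have h1 : n ≤ 2 ^ (frozenCount K n + K) :=
    (Nat.le_pow_clog one_lt_two n).trans
      (Nat.pow_le_pow_right two_pos (by unfold frozenCount; omega))
  exact_mod_cast h1

/-- The law of the binary digit at position `i`: zero if the position is frozen, fair otherwise. -/
def digitMeasure (K i : ℕ) : Measure (Fin 2) :=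
  if frozenCount K i < frozenCount K (i + 1) then Measure.dirac 0
  else ENNReal.ofReal (1 / 2) • (Measure.dirac 0 + Measure.dirac 1)

instance (K i : ℕ) : IsProbabilityMeasure (digitMeasure K i) := by
  unfold digitMeasure
  split_ifs
  · infer_instance
  · constructor
    simp only [Measure.smul_apply, Measure.add_apply, measure_univ, smul_eq_mul]
    rw [one_add_one_eq_two, ← ENNReal.ofReal_ofNat 2, ← ENNReal.ofReal_mul (by norm_num)]
    norm_num

theorem digitMeasure_singleton_of_not_lt {K i : ℕ}
    (h : ¬ frozenCount K i < frozenCount K (i + 1)) (a : Fin 2) :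
    digitMeasure K i {a} = ENNReal.ofReal (1 / 2) := by
  rw [digitMeasure, if_neg h]
  fin_cases a <;> simp

/-- Digit sequences that vanish at the frozen positions. -/
def FrozenZero (K : ℕ) (a : ℕ → Fin 2) : Prop :=
  ∀ i, frozenCount K i < frozenCount K (i + 1) → a i = 0

theorem ofReal_two_pow_frozenCount_succ {K n : ℕ} :
    ENNReal.ofReal (2 ^ frozenCount K (n + 1) / 2 ^ (n + 1)) =
      ENNReal.ofReal (2 ^ frozenCount K n / 2 ^ n) *
        (if frozenCount K n < frozenCount K (n + 1) then 1 else ENNReal.ofReal (1 / 2)) := by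
  split_ifs with h
  · have := frozenCount_succ_le K n
    have e : frozenCount K (n + 1) = frozenCount K n + 1 := by omega
    rw [e, mul_one, pow_succ, pow_succ, mul_div_mul_right _ _ (by norm_num)]
  · have e : frozenCount K (n + 1) = frozenCount K n :=
      le_antisymm (not_lt.1 h) (frozenCount_mono K n.le_succ)
    rw [e, ← ENNReal.ofReal_mul (by positivity), pow_succ]
    congr 1
    field_simp

theorem prod_digitMeasure_le (K : ℕ) (a : ℕ → Fin 2) (n : ℕ) :
    ∏ i ∈ Finset.range n, digitMeasure K i {a i} ≤
      ENNReal.ofReal (2 ^ frozenCount K n / 2 ^ n) := by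
  induction n with
  | zero => simp [frozenCount]
  | succ n ih =>
    rw [Finset.prod_range_succ, ofReal_two_pow_frozenCount_succ]
    refine mul_le_mul' ih ?_
    split_ifs with h
    · exact prob_le_one
    · exact (digitMeasure_singleton_of_not_lt h _).le

theorem prod_digitMeasure_of_frozenZero {K : ℕ} {a : ℕ → Fin 2} (ha : FrozenZero K a) (n : ℕ) :
    ∏ i ∈ Finset.range n, digitMeasure K i {a i} =
      ENNReal.ofReal (2 ^ frozenCount K n / 2 ^ n) := by
  induction n with
  | zero => simp [frozenCount]
  | succ n ih =>
    rw [Finset.prod_range_succ, ofReal_two_pow_frozenCount_succ, ih]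
    congr 1
    split_ifs with h
    · rw [ha n h, digitMeasure, if_pos h]
      simp
    · exact digitMeasure_singleton_of_not_lt h _

/-- The natural number whose binary digits are the first `n` terms of the sequence. -/
def prefixNat (a : ℕ → Fin 2) : ℕ → ℕ
  | 0 => 0
  | n + 1 => 2 * prefixNat a n + (a n : ℕ)

theorem eq_of_prefixNat_eq {a b : ℕ → Fin 2} {n : ℕ} (h : prefixNat a n = prefixNat b n) :
    ∀ i < n, a i = b i := by
  induction n with
  | zero => intro i hi; omega
  | succ n ih =>
    simp only [prefixNat] at h
    have h1 := (a n).isLt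
    have h2 := (b n).isLt
    intro i hi
    rcases Nat.lt_succ_iff_lt_or_eq.1 hi with hi | rfl
    · exact ih (by omega) i hi
    · exact Fin.ext (by omega)

theorem sum_ofDigitsTerm_eq_prefixNat_div (a : ℕ → Fin 2) (n : ℕ) :
    ∑ i ∈ Finset.range n, Real.ofDigitsTerm a i = (prefixNat a n : ℝ) / 2 ^ n := by
  induction n with
  | zero => simp [prefixNat]
  | succ n ih =>
    rw [Finset.sum_range_succ, ih, Real.ofDigitsTerm, prefixNat]
    push_cast
    rw [pow_succ]
    field_simp

theorem prefixNat_le_ofDigits (a : ℕ → Fin 2) (n : ℕ) :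
    (prefixNat a n : ℝ) ≤ 2 ^ n * Real.ofDigits a ∧
      2 ^ n * Real.ofDigits a ≤ prefixNat a n + 1 := by
  have h := Real.ofDigits_eq_sum_add_ofDigits a n
  rw [sum_ofDigitsTerm_eq_prefixNat_div] at h
  have h0 := Real.ofDigits_nonneg fun i => a (i + n)
  have h1 := Real.ofDigits_le_one fun i => a (i + n)
  have e : 2 ^ n * Real.ofDigits a = prefixNat a n + Real.ofDigits fun i => a (i + n) := by
    rw [h]; push_cast; field_simp
  constructor <;> linarith

/-- The product measure on digit sequences. -/
def digitsMeasure (K : ℕ) : Measure (ℕ → Fin 2) := Measure.infinitePi (digitMeasure K)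

instance (K : ℕ) : IsProbabilityMeasure (digitsMeasure K) := by
  unfold digitsMeasure; infer_instance

theorem digitsMeasure_cylinder (K : ℕ) (a : ℕ → Fin 2) (n : ℕ) :
    digitsMeasure K {b | ∀ i < n, b i = a i} = ∏ i ∈ Finset.range n, digitMeasure K i {a i} := by
  rw [digitsMeasure, ← Measure.infinitePi_pi (t := fun i => {a i}) _
    (fun i _ => MeasurableSet.singleton _)]
  congr 1
  ext b
  simp [Set.mem_pi]

theorem digitsMeasure_prefixNat_le (K n j : ℕ) :
    digitsMeasure K {b | prefixNat b n = j} ≤ ENNReal.ofReal (2 ^ frozenCount K n / 2 ^ n) := by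
  rcases Set.eq_empty_or_nonempty {b : ℕ → Fin 2 | prefixNat b n = j} with h | ⟨a, ha⟩
  · rw [h]; simp
  · refine le_trans (measure_mono fun b hb => ?_)
      ((digitsMeasure_cylinder K a n).trans_le (prod_digitMeasure_le K a n))
    exact eq_of_prefixNat_eq (Eq.trans hb (Eq.symm ha))

theorem ae_frozenZero (K : ℕ) : ∀ᵐ a ∂digitsMeasure K, FrozenZero K a := by
  unfold FrozenZero
  rw [ae_all_iff]
  intro i
  by_cases h : frozenCount K i < frozenCount K (i + 1)
  · have hp := measurePreserving_eval_infinitePi (digitMeasure K) i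
    have : ∀ᵐ x ∂digitMeasure K i, x = 0 := by
      rw [digitMeasure, if_pos h, ae_dirac_eq]
      exact rfl
    filter_upwards [hp.quasiMeasurePreserving.ae this] with a ha _
    exact ha
  · exact Eventually.of_forall fun a ha => absurd ha h

/-- The law of the real number with random binary digits. -/
def cantorMeasure (K : ℕ) : Measure ℝ := (digitsMeasure K).map Real.ofDigits

theorem measurable_ofDigits_two : Measurable (Real.ofDigits : (ℕ → Fin 2) → ℝ) :=
  Real.continuous_ofDigits.measurable

instance (K : ℕ) : IsProbabilityMeasure (cantorMeasure K) :=
  Measure.isProbabilityMeasure_map measurable_ofDigits_two.aemeasurable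

theorem cantorMeasure_closedBall_le (K n : ℕ) (x : ℝ) :
    cantorMeasure K (Metric.closedBall x (1 / 2 ^ n)) ≤
      ENNReal.ofReal (7 * (2 ^ frozenCount K n / 2 ^ n)) := by
  rw [cantorMeasure, Measure.map_apply measurable_ofDigits_two
    Metric.isClosed_closedBall.measurableSet]
  rcases Set.eq_empty_or_nonempty (Real.ofDigits (b := 2) ⁻¹' Metric.closedBall x (1 / 2 ^ n))
    with h | ⟨a, ha⟩
  · rw [h]; simp
  set m := prefixNat a n
  -- After scaling by 2^n two points of the ball differ by at most 2, and truncation adds at most 1: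
  -- the prefixes differ by at most 3, leaving seven cylinders.
  have hsub : Real.ofDigits (b := 2) ⁻¹' Metric.closedBall x (1 / 2 ^ n) ⊆
      ⋃ j ∈ Finset.Icc (m - 3) (m + 3), {b | prefixNat b n = j} := by
    intro b hb
    have h2 : (0 : ℝ) < 2 ^ n := by positivity
    rw [mem_preimage, Metric.mem_closedBall, Real.dist_eq, le_div_iff₀ h2] at ha hb
    have key : ∀ y : ℝ, |y - x| * 2 ^ n ≤ 1 → -1 ≤ 2 ^ n * y - 2 ^ n * x ∧
        2 ^ n * y - 2 ^ n * x ≤ 1 := by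
      intro y hy
      rw [← abs_le, ← mul_sub, abs_mul, abs_of_pos h2, mul_comm]
      exact hy
    have ka := key _ ha
    have kb := key _ hb
    have pa := prefixNat_le_ofDigits a n
    have pb := prefixNat_le_ofDigits b n
    have b1 : (prefixNat b n : ℝ) ≤ (m + 3 : ℕ) := by push_cast; linarith
    have b2 : (m : ℝ) ≤ (prefixNat b n + 3 : ℕ) := by push_cast; linarith
    rw [Nat.cast_le] at b1 b2
    refine mem_iUnion₂.2 ⟨prefixNat b n, Finset.mem_Icc.2 ⟨by omega, b1⟩, rfl⟩
  calc _ ≤ ∑ j ∈ Finset.Icc (m - 3) (m + 3), digitsMeasure K {b | prefixNat b n = j} :=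
        (measure_mono hsub).trans (measure_biUnion_finset_le _ _)
    _ ≤ ∑ j ∈ Finset.Icc (m - 3) (m + 3), ENNReal.ofReal (2 ^ frozenCount K n / 2 ^ n) :=
        Finset.sum_le_sum fun j _ => digitsMeasure_prefixNat_le K n j
    _ ≤ 7 * ENNReal.ofReal (2 ^ frozenCount K n / 2 ^ n) := by
        rw [Finset.sum_const, nsmul_eq_mul, Nat.card_Icc]
        gcongr
        have : m + 3 + 1 - (m - 3) ≤ 7 := by omega
        exact_mod_cast this
    _ = _ := by rw [ENNReal.ofReal_mul (by norm_num), ENNReal.ofReal_ofNat]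

theorem le_cantorMeasure_closedBall {K : ℕ} {a : ℕ → Fin 2} (ha : FrozenZero K a) (n : ℕ) :
    ENNReal.ofReal ((n : ℝ) / 2 ^ K / 2 ^ n) ≤
      cantorMeasure K (Metric.closedBall (Real.ofDigits a) (1 / 2 ^ n)) := by
  rw [cantorMeasure, Measure.map_apply measurable_ofDigits_two
    Metric.isClosed_closedBall.measurableSet]
  calc _ ≤ ENNReal.ofReal (2 ^ frozenCount K n / 2 ^ n) := by
        apply ENNReal.ofReal_le_ofReal
        gcongr
        exact div_le_two_pow_frozenCount K n
    _ = digitsMeasure K {b | ∀ i < n, b i = a i} := by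
        rw [digitsMeasure_cylinder, prod_digitMeasure_of_frozenZero ha]
    _ ≤ _ := by
        refine measure_mono fun b hb => ?_
        rw [mem_preimage, Metric.mem_closedBall, Real.dist_eq]
        refine (Real.abs_ofDigits_sub_ofDigits_le hb).trans_eq ?_
        simp

/-- With d the diameter and d ≤ 2^{-n} < 2d, the ball bound 14 n 2^{-n} / 2^K and n ≤ 2|log d| give
the constant 56. The restriction on d forces n ≥ 2^K. -/
theorem cantorMeasure_le_gauge {K : ℕ} {s : Set ℝ}
    (hs : Metric.ediam s ≤ ENNReal.ofReal (1 / 2 ^ 2 ^ K)) :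
    cantorMeasure K s ≤ ENNReal.ofReal (56 / 2 ^ K *
      ((Metric.ediam s).toReal * |Real.log (Metric.ediam s).toReal|)) := by
  rcases s.eq_empty_or_nonempty with rfl | ⟨x, hx⟩
  · simp
  set d := (Metric.ediam s).toReal with hd
  have htop : Metric.ediam s ≠ ⊤ := (hs.trans_lt ENNReal.ofReal_lt_top).ne
  have hd0 : 0 ≤ d := ENNReal.toReal_nonneg
  have hdle : d ≤ 1 / 2 ^ 2 ^ K := ENNReal.toReal_le_of_le_ofReal (by positivity) hs
  have hsub : s ⊆ Metric.closedBall x d := by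
    intro y hy
    rw [Metric.mem_closedBall, dist_edist]
    exact ENNReal.toReal_mono htop (Metric.edist_le_ediam_of_mem hy hx)
  have hball : ∀ n : ℕ, 2 ^ K ≤ n → d ≤ 1 / 2 ^ n →
      cantorMeasure K s ≤ ENNReal.ofReal (7 * (2 * n / 2 ^ K / 2 ^ n)) := by
    intro n hn hdn
    refine (measure_mono (hsub.trans (Metric.closedBall_subset_closedBall hdn))).trans
      ((cantorMeasure_closedBall_le K n x).trans (ENNReal.ofReal_le_ofReal ?_))
    gcongr
    exact two_pow_frozenCount_le_div hn
  rcases hd0.eq_or_lt with h | h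
  -- At diameter 0 the gauge vanishes, so the measure must have no atoms.
  · have lim : Tendsto (fun n : ℕ => ENNReal.ofReal (7 * (2 * n / 2 ^ K / 2 ^ n))) atTop (𝓝 0) := by
      have := (tendsto_self_mul_const_pow_of_lt_one (r := (1 / 2 : ℝ)) (by norm_num)
        (by norm_num)).const_mul (14 / 2 ^ K : ℝ)
      rw [mul_zero] at this
      rw [← ENNReal.ofReal_zero]
      refine ENNReal.tendsto_ofReal (this.congr fun n => ?_)
      rw [one_div, inv_pow]
      ring
    refine le_trans ?_ zero_le
    refine ge_of_tendsto lim ?_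
    filter_upwards [eventually_ge_atTop (2 ^ K)] with n hn
    exact hball n hn (by rw [← h]; positivity)
  · have hd1 : d ≤ 1 := hdle.trans (by
      rw [div_le_one (by positivity)]; exact one_le_pow₀ (by norm_num))
    obtain ⟨n, h1, h2, h3, -⟩ := exists_dyadic_scale h hd1
    have hn : 2 ^ K ≤ n := by
      have : (1 : ℝ) / 2 ^ n < 2 * (1 / 2 ^ 2 ^ K) := h2.trans_le (by gcongr)
      rw [mul_one_div, div_lt_div_iff₀ (by positivity) (by positivity), one_mul, ← pow_succ',
        pow_lt_pow_iff_right₀ (by norm_num)] at this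
      omega
    refine (hball n hn h1).trans (ENNReal.ofReal_le_ofReal ?_)
    calc 7 * (2 * (n : ℝ) / 2 ^ K / 2 ^ n) = 14 / 2 ^ K * (n * (1 / 2 ^ n)) := by
          ring
      _ ≤ 14 / 2 ^ K * (2 * |Real.log d| * (2 * d)) := by gcongr
      _ = _ := by ring

/-- A set of full measure for `cantorMeasure K` has large Hausdorff measure. -/
theorem le_gaugeMeasure_of_cantorMeasure {K : ℕ} {s : Set ℝ} (hs : 1 ≤ cantorMeasure K s) :
    ENNReal.ofReal (2 ^ K / 56) ≤ gaugeMeasure (fun t => t * |Real.log t|) s := by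
  have h : ENNReal.ofReal (2 ^ K / 56) • cantorMeasure K ≤
      gaugeMeasure (fun t => t * |Real.log t|) := by
    refine Measure.le_mkMetric _ _ (ENNReal.ofReal (1 / 2 ^ 2 ^ K))
      (ENNReal.ofReal_pos.2 (by positivity)) fun t ht => ?_
    rw [Measure.smul_apply, smul_eq_mul]
    refine (mul_le_mul_right (cantorMeasure_le_gauge ht) _).trans_eq ?_
    rw [← ENNReal.ofReal_mul (by positivity)]
    congr 1
    field_simp
  calc ENNReal.ofReal (2 ^ K / 56) ≤ ENNReal.ofReal (2 ^ K / 56) * cantorMeasure K s :=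
        le_mul_of_one_le_right' hs
    _ ≤ _ := h s

/-- A weighted sum of the measures `cantorMeasure K`. -/
def cantorMixture : Measure ℝ :=
  Measure.sum fun K => (2⁻¹ : ENNReal) ^ (K + 1) • cantorMeasure K

theorem tsum_two_inv_pow_succ : ∑' K : ℕ, (2⁻¹ : ENNReal) ^ (K + 1) = 1 := by
  rw [ENNReal.tsum_geometric_add_one, ENNReal.one_sub_inv_two, inv_inv,
    ENNReal.inv_mul_cancel (by norm_num) (by norm_num)]

theorem cantorMixture_le {s : Set ℝ} (hs : MeasurableSet s) {c : ENNReal}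
    (h : ∀ K, cantorMeasure K s ≤ c) : cantorMixture s ≤ c := by
  rw [cantorMixture, Measure.sum_apply _ hs]
  calc _ ≤ ∑' K : ℕ, (2⁻¹ : ENNReal) ^ (K + 1) * c := by
        refine ENNReal.tsum_le_tsum fun K => ?_
        rw [Measure.smul_apply, smul_eq_mul]
        exact mul_le_mul_right (h K) _
    _ = c := by rw [ENNReal.tsum_mul_right, tsum_two_inv_pow_succ, one_mul]

instance : IsProbabilityMeasure cantorMixture := by
  constructor
  rw [cantorMixture, Measure.sum_apply _ MeasurableSet.univ]
  simp only [Measure.smul_apply, measure_univ, smul_eq_mul, mul_one]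
  exact tsum_two_inv_pow_succ

/-- The bound 2^`frozenCount` ≤ 2n does not involve K, so it survives mixing. -/
theorem cantorMixture_closedBall_le {n : ℕ} (hn : 1 ≤ n) (x : ℝ) :
    cantorMixture.real (Metric.closedBall x (1 / 2 ^ n)) ≤ 14 * n / 2 ^ n := by
  refine ENNReal.toReal_le_of_le_ofReal (by positivity)
    (cantorMixture_le Metric.isClosed_closedBall.measurableSet fun K =>
      (cantorMeasure_closedBall_le K n x).trans (ENNReal.ofReal_le_ofReal ?_))
  rw [← mul_div_assoc]
  refine div_le_div_of_nonneg_right ?_ (by positivity)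
  linarith [two_pow_frozenCount_le K hn]

theorem ae_cantorMixture_mem_Icc : ∀ᵐ t ∂cantorMixture, t ∈ Icc (0 : ℝ) 1 := by
  rw [ae_iff]
  refine le_antisymm (cantorMixture_le measurableSet_Icc.compl fun K => ?_) zero_le
  rw [cantorMeasure, Measure.map_apply measurable_ofDigits_two measurableSet_Icc.compl]
  refine le_of_eq ?_
  convert measure_empty (μ := digitsMeasure K)
  refine eq_empty_of_forall_notMem fun a ha => ha ?_
  exact ⟨Real.ofDigits_nonneg a, Real.ofDigits_le_one a⟩

theorem le_cantorMixture_closedBall {K : ℕ} {a : ℕ → Fin 2} (ha : FrozenZero K a) (n : ℕ) :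
    (1 / 2) ^ (K + 1) * ((n : ℝ) / 2 ^ K / 2 ^ n) ≤
      cantorMixture.real (Metric.closedBall (Real.ofDigits a) (1 / 2 ^ n)) := by
  rw [measureReal_def, ← ENNReal.ofReal_le_iff_le_toReal (measure_ne_top _ _)]
  calc _ = (2⁻¹ : ENNReal) ^ (K + 1) * ENNReal.ofReal ((n : ℝ) / 2 ^ K / 2 ^ n) := by
        rw [ENNReal.ofReal_mul (by positivity), ENNReal.ofReal_pow (by norm_num), one_div,
          ENNReal.ofReal_inv_of_pos (by norm_num), ENNReal.ofReal_ofNat]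
    _ ≤ ((2⁻¹ : ENNReal) ^ (K + 1) • cantorMeasure K)
          (Metric.closedBall (Real.ofDigits a) (1 / 2 ^ n)) := by
        rw [Measure.smul_apply, smul_eq_mul]
        exact mul_le_mul_right (le_cantorMeasure_closedBall ha n) _
    _ ≤ _ := Measure.le_sum (fun K => (2⁻¹ : ENNReal) ^ (K + 1) • cantorMeasure K) K _

end

/-! ### Herglotz integrals and the second assertion. -/

noncomputable section

/-- The Herglotz integral of a measure on the circle, parametrized by the angle. -/
def herglotzIntegral (μ : Measure ℝ) (z : ℂ) : ℂ :=
  ∫ t : ℝ, herglotzRieszKernel 0 z (Complex.exp (t * Complex.I)) ∂μ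

theorem one_sub_norm_le_norm_exp_sub (t : ℝ) (z : ℂ) :
    1 - ‖z‖ ≤ ‖Complex.exp (t * Complex.I) - z‖ := by
  have := norm_sub_norm_le (Complex.exp (t * Complex.I)) z
  rwa [Complex.norm_exp_ofReal_mul_I] at this

theorem exp_mul_I_sub_ne_zero {z : ℂ} (hz : ‖z‖ < 1) (t : ℝ) :
    Complex.exp (t * Complex.I) - z ≠ 0 :=
  norm_pos_iff.1 ((sub_pos.2 hz).trans_le (one_sub_norm_le_norm_exp_sub t z))

theorem continuous_herglotzRieszKernel_exp {z : ℂ} (hz : ‖z‖ < 1) :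
    Continuous fun t : ℝ => herglotzRieszKernel 0 z (Complex.exp (t * Complex.I)) := by
  simp only [herglotzRieszKernel_def, sub_zero]
  exact Continuous.div (by fun_prop) (by fun_prop) fun t => exp_mul_I_sub_ne_zero hz t

variable {μ : Measure ℝ} [IsProbabilityMeasure μ]

theorem integrable_herglotzRieszKernel_exp {z : ℂ} (hz : ‖z‖ < 1) :
    Integrable (fun t : ℝ => herglotzRieszKernel 0 z (Complex.exp (t * Complex.I))) μ := by
  refine Integrable.of_bound (continuous_herglotzRieszKernel_exp hz).aestronglyMeasurable
    (2 / (1 - ‖z‖)) (ae_of_all _ fun t => ?_)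
  have h := sub_pos.2 hz
  rw [herglotzRieszKernel_def, sub_zero, sub_zero, norm_div]
  gcongr
  · refine (norm_add_le _ _).trans ?_
    rw [Complex.norm_exp_ofReal_mul_I]; linarith
  · exact one_sub_norm_le_norm_exp_sub t z

theorem analyticOnNhd_herglotzIntegral : AnalyticOnNhd ℂ (herglotzIntegral μ) (Metric.ball 0 1) := by
  refine DifferentiableOn.analyticOnNhd (fun z hz => ?_) Metric.isOpen_ball
  rw [mem_ball_zero_iff] at hz
  set d : ℝ := (1 - ‖z‖) / 2 with hd
  have hd0 : 0 < d := by rw [hd]; linarith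
  have hnear : ∀ w ∈ Metric.ball z d, ‖w‖ < 1 ∧ d ≤ 1 - ‖w‖ := by
    intro w hw
    rw [mem_ball_iff_norm] at hw
    have := norm_sub_norm_le w z
    constructor <;> linarith
  have h := hasDerivAt_integral_of_dominated_loc_of_deriv_le (μ := μ)
    (F := fun (w : ℂ) (t : ℝ) => herglotzRieszKernel 0 w (Complex.exp (t * Complex.I)))
    (F' := fun (w : ℂ) (t : ℝ) => 2 * Complex.exp (t * Complex.I) /
      (Complex.exp (t * Complex.I) - w) ^ 2) (bound := fun _ => 2 / d ^ 2)
    (Metric.ball_mem_nhds z hd0)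
    (eventually_of_mem (Metric.ball_mem_nhds z hd0) fun w hw =>
      (continuous_herglotzRieszKernel_exp (hnear w hw).1).aestronglyMeasurable)
    (integrable_herglotzRieszKernel_exp hz)
    (Continuous.aestronglyMeasurable <| Continuous.div (by fun_prop) (by fun_prop)
      fun t => pow_ne_zero _ (exp_mul_I_sub_ne_zero hz t))
    (ae_of_all _ fun t w hw => by
      rw [norm_div, norm_mul, Complex.norm_exp_ofReal_mul_I, norm_pow, mul_one, Complex.norm_two]
      have := (hnear w hw).2.trans (one_sub_norm_le_norm_exp_sub t w)
      gcongr)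
    (integrable_const _)
    (ae_of_all _ fun t w hw => by
      have h1 := exp_mul_I_sub_ne_zero (hnear w hw).1 t
      have h3 := ((hasDerivAt_id' w).const_add (Complex.exp (t * Complex.I))).div
        ((hasDerivAt_id' w).const_sub (Complex.exp (t * Complex.I))) h1
      simpa [herglotzRieszKernel_def, sub_zero, sub_sub, ← two_mul, Pi.div_def] using h3)
  exact h.2.differentiableAt.differentiableWithinAt

theorem re_herglotzRieszKernel_exp (z : ℂ) (t : ℝ) :
    (herglotzRieszKernel 0 z (Complex.exp (t * Complex.I))).re =
      (1 - ‖z‖ ^ 2) / ‖Complex.exp (t * Complex.I) - z‖ ^ 2 := by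
  have := congrFun (poissonKernel_eq_re_herglotzRieszKernel (c := 0) (w := z))
    (Complex.exp (t * Complex.I))
  rw [Function.comp_apply] at this
  rw [← this, poissonKernel_def, sub_zero, sub_zero, Complex.norm_exp_ofReal_mul_I, one_pow]

theorem re_herglotzIntegral {z : ℂ} (hz : ‖z‖ < 1) :
    Integrable (fun t : ℝ => (1 - ‖z‖ ^ 2) / ‖Complex.exp (t * Complex.I) - z‖ ^ 2) μ ∧
    (herglotzIntegral μ z).re =
      ∫ t : ℝ, (1 - ‖z‖ ^ 2) / ‖Complex.exp (t * Complex.I) - z‖ ^ 2 ∂μ := by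
  have hi := integrable_herglotzRieszKernel_exp (μ := μ) hz
  simp_rw [← re_herglotzRieszKernel_exp]
  exact ⟨hi.re, (integral_re hi).symm⟩

theorem re_herglotzIntegral_nonneg {z : ℂ} (hz : ‖z‖ < 1) : 0 ≤ (herglotzIntegral μ z).re := by
  rw [(re_herglotzIntegral hz).2]
  refine integral_nonneg fun t => ?_
  have : ‖z‖ ^ 2 ≤ 1 := pow_le_one₀ (norm_nonneg z) hz.le
  exact div_nonneg (by linarith) (by positivity)

theorem norm_exp_sub_exp_sq (t θ : ℝ) :
    ‖Complex.exp (t * Complex.I) - Complex.exp (θ * Complex.I)‖ ^ 2 =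
      4 * Real.sin ((t - θ) / 2) ^ 2 := by
  have := norm_mul_exp_sub_mul_exp_sq 1 1 t θ
  rw [Complex.ofReal_one, one_mul, one_mul] at this
  rw [this]; ring

theorem abs_sub_le_two_mul_norm_exp_sub {t θ : ℝ} (ht : t ∈ Icc (0 : ℝ) 1)
    (hθ : θ ∈ Icc (0 : ℝ) 1) :
    |t - θ| ≤ 2 * ‖Complex.exp (t * Complex.I) - Complex.exp (θ * Complex.I)‖ := by
  have hπ := Real.pi_gt_three
  have h1 : |t - θ| ≤ Real.pi := by
    rw [abs_le]; constructor <;> linarith [ht.1, ht.2, hθ.1, hθ.2]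
  have h2 := sq_div_pi_le_sin_half_sq h1
  refine abs_le_of_sq_le_sq' (a := |t - θ|) ?_ (by positivity) |>.2
  rw [sq_abs, mul_pow, norm_exp_sub_exp_sq]
  rw [div_pow, div_le_iff₀ (by positivity)] at h2
  refine h2.trans ?_
  have : Real.pi ^ 2 ≤ 16 := by nlinarith [Real.pi_lt_four]
  nlinarith [sq_nonneg (Real.sin ((t - θ) / 2))]

/-- The logarithm is frozen at the smallest scale h, so that the dyadic sum stays geometric. Radii s
≥ 1/2 are covered by the total mass 1. -/
theorem measureReal_closedBall_le_mul_log
    (hball : ∀ (n : ℕ) (x : ℝ), 1 ≤ n → μ.real (Metric.closedBall x (1 / 2 ^ n)) ≤ 14 * n / 2 ^ n)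
    {h s : ℝ} (hh : 0 < h) (hh1 : h ≤ 1) (hs : h ≤ s) (x : ℝ) :
    μ.real (Metric.closedBall x s) ≤ 56 * s * (1 + |Real.log h|) := by
  have hs0 : 0 < s := hh.trans_le hs
  have habs := abs_nonneg (Real.log h)
  rcases le_or_gt (1 / 2) s with hs2 | hs2
  · refine measureReal_le_one.trans ?_
    nlinarith
  · obtain ⟨n, h1, h2, h3, -⟩ := exists_dyadic_scale hs0 (by linarith)
    have hn : 1 ≤ n := by
      by_contra hn
      have : n = 0 := by omega
      subst this
      norm_num at h2
      linarith
    have hl : |Real.log s| ≤ |Real.log h| := by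
      rw [abs_of_nonpos (Real.log_nonpos hs0.le (by linarith)),
        abs_of_nonpos (Real.log_nonpos hh.le hh1)]
      exact neg_le_neg (Real.log_le_log hh hs)
    calc μ.real (Metric.closedBall x s) ≤ μ.real (Metric.closedBall x (1 / 2 ^ n)) :=
          measureReal_mono (Metric.closedBall_subset_closedBall h1)
      _ ≤ 14 * n / 2 ^ n := hball n x hn
      _ = 14 * (n * (1 / 2 ^ n)) := by ring
      _ ≤ 14 * (2 * |Real.log s| * (2 * s)) := by gcongr
      _ ≤ 56 * s * (1 + |Real.log h|) := by nlinarith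

/-- The dyadic splitting is applied to D(t) = |e^{it} - z| itself, without reference to arg z: a
sublevel set D ≤ s is, up to a null set, inside a ball of radius 4s about any of its points in [0,
1]. -/
theorem re_herglotzIntegral_le (hsupp : ∀ᵐ t ∂μ, t ∈ Icc (0 : ℝ) 1)
    (hball : ∀ (n : ℕ) (x : ℝ), 1 ≤ n → μ.real (Metric.closedBall x (1 / 2 ^ n)) ≤ 14 * n / 2 ^ n)
    {z : ℂ} (hz : ‖z‖ < 1) :
    (herglotzIntegral μ z).re ≤ 3600 * (1 + |Real.log (1 - ‖z‖)|) := by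
  set h : ℝ := 1 - ‖z‖ with hdef
  have hh : 0 < h := sub_pos.2 hz
  have hh1 : h ≤ 1 := by rw [hdef]; linarith [norm_nonneg z]
  set D : ℝ → ℝ := fun t => ‖Complex.exp (t * Complex.I) - z‖ with hD
  have hDc : Continuous D := by fun_prop
  have hDh : ∀ t, h ≤ D t := fun t => one_sub_norm_le_norm_exp_sub t z
  set L := 1 + |Real.log h| with hL
  have hL1 : 1 ≤ L := by rw [hL]; linarith [abs_nonneg (Real.log h)]
  -- This J makes the remainder 4^{-J}/h at most 1.
  obtain ⟨J, hJ⟩ := exists_pow_lt_of_lt_one hh (show (1 / 4 : ℝ) < 1 by norm_num)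
  have hset : ∀ s, h ≤ s → μ.real {t | D t ≤ s} ≤ 224 * s * L := by
    intro s hs
    have hs0 : 0 < s := hh.trans_le hs
    by_cases hne : ∃ t₀ ∈ Icc (0 : ℝ) 1, D t₀ ≤ s
    · obtain ⟨t₀, ht₀, hDt₀⟩ := hne
      have : μ.real {t | D t ≤ s} ≤ μ.real (Metric.closedBall t₀ (4 * s)) := by
        refine ENNReal.toReal_mono (measure_ne_top _ _) (measure_mono_ae ?_)
        filter_upwards [hsupp] with t ht htD
        have h1 := abs_sub_le_two_mul_norm_exp_sub ht ht₀
        have h2 := norm_sub_le_norm_sub_add_norm_sub (Complex.exp (t * Complex.I)) z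
          (Complex.exp (t₀ * Complex.I))
        rw [norm_sub_rev z] at h2
        have h3 : D t ≤ s := htD
        simp only [hD] at h3 hDt₀
        change t ∈ Metric.closedBall t₀ (4 * s)
        rw [Metric.mem_closedBall, Real.dist_eq]
        linarith
      refine this.trans ((measureReal_closedBall_le_mul_log hball hh hh1
        (by linarith) t₀).trans_eq ?_)
      rw [hL]; ring
    · push Not at hne
      have : μ {t | D t ≤ s} = 0 := by
        have hsub : {t | D t ≤ s} ⊆ {t | ¬ t ∈ Icc (0 : ℝ) 1} :=
          fun t ht hmem => absurd ht (not_le.2 (hne t hmem))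
        exact measure_mono_null hsub (ae_iff.1 hsupp)
      rw [measureReal_def, this]
      simp only [ENNReal.toReal_zero]
      positivity
  set g : ℕ → ℝ → ℝ := fun j t => 4 * (4 ^ j : ℝ)⁻¹ / h * {t | D t ≤ 2 ^ j * h}.indicator 1 t
    with hg
  have hmeas : ∀ s, MeasurableSet {t | D t ≤ s} := fun s =>
    (isClosed_le hDc continuous_const).measurableSet
  have hgi : ∀ j, Integrable (g j) μ := fun j =>
    ((integrable_const (1 : ℝ)).indicator (hmeas _)).const_mul _
  have hgint : ∀ j, ∫ t, g j t ∂μ ≤ 896 * L * ((4 ^ j : ℝ)⁻¹ * 2 ^ j) := by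
    intro j
    rw [hg, integral_const_mul, integral_indicator_one (hmeas _)]
    have : h ≤ 2 ^ j * h := le_mul_of_one_le_left hh.le (one_le_pow₀ (by norm_num))
    calc _ ≤ 4 * (4 ^ j : ℝ)⁻¹ / h * (224 * (2 ^ j * h) * L) := by
          gcongr
          exact hset _ this
      _ = _ := by field_simp; norm_num
  have hpt : ∀ t, (1 - ‖z‖ ^ 2) / D t ^ 2 ≤
      2 * ((∑ j ∈ Finset.range (J + 1), g j t) + (4 ^ J : ℝ)⁻¹ / h) := by
    intro t
    have h1 := div_max_sq_le_dyadic_sum (d := D t) hh J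
    have h2 : max (h ^ 2) (D t ^ 2) = D t ^ 2 :=
      max_eq_right (pow_le_pow_left₀ hh.le (hDh t) 2)
    rw [h2] at h1
    have h3 : 1 - ‖z‖ ^ 2 ≤ 2 * h := by rw [hdef]; nlinarith [sq_nonneg (1 - ‖z‖)]
    have hDt : 0 < D t := hh.trans_le (hDh t)
    calc (1 - ‖z‖ ^ 2) / D t ^ 2 ≤ 2 * h / D t ^ 2 := by gcongr
      _ = 2 * (h / D t ^ 2) := by ring
      _ ≤ _ := by
        refine mul_le_mul_of_nonneg_left (h1.trans (le_of_eq ?_)) (by norm_num)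
        congr 1
        refine Finset.sum_congr rfl fun j _ => ?_
        simp only [hg, indicator, mem_ofPred_eq, abs_of_pos hDt, Pi.one_apply]
  have hS : Integrable (fun t => ∑ j ∈ Finset.range (J + 1), g j t) μ :=
    integrable_finsetSum _ fun j _ => hgi j
  rw [(re_herglotzIntegral hz).2]
  refine (integral_mono (re_herglotzIntegral hz).1
    ((hS.add (integrable_const _)).const_mul 2) hpt).trans ?_
  rw [integral_const_mul, integral_add' hS (integrable_const _),
    integral_finsetSum _ fun j _ => hgi j, integral_const, probReal_univ, one_smul]
  have s1 : ∑ j ∈ Finset.range (J + 1), ∫ t, g j t ∂μ ≤ 896 * L * 2 := by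
    refine (Finset.sum_le_sum fun j _ => hgint j).trans ?_
    rw [← Finset.mul_sum]
    gcongr
    exact sum_inv_four_pow_mul_two_pow_le _
  have s2 : (4 ^ J : ℝ)⁻¹ / h ≤ 1 := by
    rw [div_le_one hh, ← inv_pow, ← one_div]
    exact hJ.le
  linarith

/-- On the ball the squared distance is at most (1-r)² + r(t-θ)² ≤ 2(1-r)², and the numerator 1-r²
is at least 1-r. -/
theorem le_re_herglotzIntegral {θ r : ℝ} (hr : r ∈ Ioo (0 : ℝ) 1) {δ : ℝ} (hδ : δ ≤ 1 - r) :
    1 / (2 * (1 - r)) * μ.real (Metric.closedBall θ δ) ≤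
      (herglotzIntegral μ (r * Complex.exp (θ * Complex.I))).re := by
  have hz : ‖(r : ℂ) * Complex.exp (θ * Complex.I)‖ = r := by
    rw [norm_mul, Complex.norm_exp_ofReal_mul_I, mul_one, Complex.norm_real, Real.norm_eq_abs,
      abs_of_pos hr.1]
  have hz1 : ‖(r : ℂ) * Complex.exp (θ * Complex.I)‖ < 1 := hz.trans_lt hr.2
  obtain ⟨hi, he⟩ := re_herglotzIntegral (μ := μ) hz1
  have hpos := sub_pos.2 hr.2
  rw [he, mul_comm, ← smul_eq_mul, ← setIntegral_const]
  rw [hz] at hi ⊢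
  refine le_trans ?_ (setIntegral_le_integral (s := Metric.closedBall θ δ) hi (ae_of_all _ fun t => ?_))
  · refine setIntegral_mono_on (integrableOn_const (measure_ne_top _ _)) hi.integrableOn
      Metric.isClosed_closedBall.measurableSet fun t ht => ?_
    have hD := norm_mul_exp_sub_mul_exp_sq 1 r t θ
    rw [Complex.ofReal_one, one_mul, mul_one] at hD
    have hlow := one_sub_norm_le_norm_exp_sub t ((r : ℂ) * Complex.exp (θ * Complex.I))
    rw [hz] at hlow
    have hDpos := hpos.trans_le hlow
    rw [Metric.mem_closedBall, Real.dist_eq] at ht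
    have hsin : Real.sin ((t - θ) / 2) ^ 2 ≤ ((t - θ) / 2) ^ 2 := Real.sin_sq_le_sq
    have hsq : (t - θ) ^ 2 ≤ (1 - r) ^ 2 := by
      rw [← sq_abs (t - θ)]
      exact pow_le_pow_left₀ (abs_nonneg _) (ht.trans hδ) 2
    have hup : ‖Complex.exp (t * Complex.I) - r * Complex.exp (θ * Complex.I)‖ ^ 2 ≤
        2 * (1 - r) ^ 2 := by
      rw [hD]
      nlinarith [hr.1, hr.2, sq_nonneg (Real.sin ((t - θ) / 2))]
    rw [div_le_div_iff₀ (by positivity) (by positivity), one_mul]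
    refine hup.trans ?_
    nlinarith [hr.1, hr.2, mul_pos hr.1 hpos]
  · have : r ^ 2 ≤ 1 := pow_le_one₀ hr.1.le hr.2.le
    exact div_nonneg (by linarith) (by positivity)

theorem le_re_herglotzIntegral_cantorMixture {K : ℕ} {a : ℕ → Fin 2} (ha : FrozenZero K a)
    {r : ℝ} (hr : r ∈ Ioo (0 : ℝ) 1) :
    (1 / 2) ^ (K + 1) / 2 ^ K / 4 * |Real.log (1 - r)| ≤
      (herglotzIntegral cantorMixture (r * Complex.exp (Real.ofDigits a * Complex.I))).re := by
  have hpos := sub_pos.2 hr.2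
  -- The scale used is n + 1: its radius is at most 1-r and at least half of it, and |log(1-r)| ≤ n
  -- + 1.
  obtain ⟨n, h1, h2, -, h4⟩ := exists_dyadic_scale hpos (by linarith [hr.1])
  have hlow : (1 - r) / 2 ≤ 1 / 2 ^ (n + 1) := by
    rw [pow_succ, ← div_div]; linarith
  have hup : (1 : ℝ) / 2 ^ (n + 1) ≤ 1 - r := by
    rw [pow_succ, ← div_div]; linarith
  refine le_trans ?_ (le_re_herglotzIntegral hr hup)
  have hm := le_cantorMixture_closedBall ha (n + 1)
  calc _ = 1 / (2 * (1 - r)) * ((1 / 2) ^ (K + 1) *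
        (|Real.log (1 - r)| / 2 ^ K * ((1 - r) / 2))) := by field_simp; norm_num
    _ ≤ 1 / (2 * (1 - r)) * ((1 / 2) ^ (K + 1) * (((n + 1 : ℕ) : ℝ) / 2 ^ K / 2 ^ (n + 1))) := by
        rw [div_eq_mul_one_div _ ((2 : ℝ) ^ (n + 1))]
        push_cast
        gcongr
    _ ≤ _ := by gcongr

theorem exists_gaugeMeasure_DPlus_eq_top :
    ∃ f : ℂ → ℂ, IsKorenblum f ∧ IsBoundedBelowOnDisc f ∧
      gaugeMeasure (fun t => t * |Real.log t|) (DPlus f) = ⊤ := by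
  set F := herglotzIntegral cantorMixture with hF
  have hupper : ∀ z : ℂ, ‖z‖ < 1 → (F z).re ≤ 3600 * (1 + |Real.log (1 - ‖z‖)|) := fun z hz =>
    re_herglotzIntegral_le ae_cantorMixture_mem_Icc
      (fun n x hn => cantorMixture_closedBall_le hn x) hz
  refine ⟨fun z => Complex.exp (F z), ⟨fun z hz => ?_, Real.exp 3600, 3600, fun z hz => ?_⟩,
    ⟨1, one_pos, fun z hz => ?_⟩, ?_⟩
  · exact (analyticOnNhd_herglotzIntegral z hz).cexp
  · rw [mem_ball_zero_iff] at hz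
    have hpos := sub_pos.2 hz
    rw [Complex.norm_exp, Real.rpow_def_of_pos hpos, ← Real.exp_sub, Real.exp_le_exp]
    have := hupper z hz
    rw [abs_of_nonpos (Real.log_nonpos hpos.le (by linarith [norm_nonneg z]))] at this
    linarith
  · rw [mem_ball_zero_iff] at hz
    rw [Complex.norm_exp, Real.one_le_exp_iff]
    exact re_herglotzIntegral_nonneg hz
  · have hmem : ∀ K a, FrozenZero K a →
        Real.ofDigits a ∈ DPlus fun z => Complex.exp (F z) := by
      intro K a ha
      refine ⟨⟨Real.ofDigits_nonneg a, ?_⟩, ?_⟩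
      · linarith [Real.ofDigits_le_one a, Real.pi_gt_three]
      · have hc : (0 : ℝ) < (1 / 2) ^ (K + 1) / 2 ^ K / 4 := by positivity
        refine lt_of_lt_of_le (EReal.coe_pos.2 hc) (le_liminf_of_le (by isBoundedDefault) ?_)
        filter_upwards [Ioo_mem_nhdsLT (zero_lt_one (α := ℝ))] with r hr
        rw [radialRatio_eq_coe (f := fun z => Complex.exp (F z)) (Complex.exp_ne_zero _), EReal.coe_le_coe_iff, Complex.norm_exp,
          Real.log_exp, le_div_iff₀]
        · exact le_re_herglotzIntegral_cantorMixture ha hr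
        · exact abs_pos.2 (Real.log_neg (sub_pos.2 hr.2) (by linarith [hr.1])).ne
    have hK : ∀ K : ℕ, ENNReal.ofReal (2 ^ K / 56) ≤
        gaugeMeasure (fun t => t * |Real.log t|) (DPlus fun z => Complex.exp (F z)) := by
      intro K
      refine le_gaugeMeasure_of_cantorMeasure ?_
      -- This direction of the push-forward inequality holds for every set, so measurability of
      -- `DPlus` is not needed.
      refine le_trans ?_ (Measure.le_map_apply measurable_ofDigits_two.aemeasurable _)
      rw [← measure_univ (μ := digitsMeasure K)]
      refine measure_mono_ae ?_
      filter_upwards [ae_frozenZero K] with a ha _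
      exact hmem K a ha
    refine top_le_iff.1 (le_of_tendsto' (x := atTop) ?_ hK)
    refine ENNReal.tendsto_ofReal_atTop.comp ?_
    exact (tendsto_pow_atTop_atTop_of_one_lt one_lt_two).atTop_div_const (by norm_num)

end

theorem mainTheorem5 :
    (∀ f : ℂ → ℂ, IsKorenblum f → IsBoundedBelowOnDisc f →
      ∃ S : ℕ → Set ℝ, GPlus f = ⋃ n, S n ∧
        ∀ n, gaugeMeasure (fun t => t * |Real.log t|) (S n) < ⊤) ∧
    (∃ f : ℂ → ℂ, IsKorenblum f ∧ IsBoundedBelowOnDisc f ∧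
      gaugeMeasure (fun t => t * |Real.log t|) (DPlus f) = ⊤) :=
  ⟨fun _ hf hb => exists_iUnion_eq_GPlus hf hb, exists_gaugeMeasure_DPlus_eq_top⟩
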